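/- Let $X$ be a real or complex Banach space, let $Y$ be a closed linear subspace of $X$, and let $X/Y$ carry the quotient norm. A pair $(E,F)$, where $E$ is a closed subspace of a Banach space $F$ with inclusion map $J\colon E\to F$, is called a Daugavet pair if $\|J+T\|=1+\|T\|$ for every bounded linear operator $T\colon E\to F$ of rank one; $F$ is called a Daugavet space if $(F,F)$ is a Daugavet pair. A Banach space $Z$ has the Radon–Nikodým property if for every finite measure space $(\Omega,\Sigma,\mu)$ and every countably additive measure $G\colon\Sigma\to Z$ of bounded variation that is absolutely continuous with respect to $\mu$ there is a Bochner integrable function $g\colon\Omega\to Z$ such that $G(E)=\int_E g\,d\mu$ for all $E\in\Sigma$. Suppose that $X$ is a Daugavet space. Then: (a) If $X/Y$ has the Radon–Nikodým property, then $(Y,X)$ is a Daugavet pair. (b) If $Y$ is reflexive, then $X/Y$ is a Daugavet space. -/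

import Mathlib

universe u

open MeasureTheory
open scoped ENNReal

/-- The Daugavet property of a bounded operator `J : E → F` (used below with `J` the inclusion of a
subspace, or the identity): the Daugavet equation `‖J + T‖ = 1 + ‖T‖` holds for all bounded linear
operators `T : E → F` of rank one. -/
def HasDaugavetProperty {𝕜 E F : Type*} [RCLike 𝕜]
    [SeminormedAddCommGroup E] [NormedSpace 𝕜 E] [SeminormedAddCommGroup F] [NormedSpace 𝕜 F]
    (J : E →L[𝕜] F) : Prop :=
  ∀ T : E →L[𝕜] F, LinearMap.rank (T : E →ₗ[𝕜] F) = 1 → ‖J + T‖ = 1 + ‖T‖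

/-- `(Y, X)` is a Daugavet pair, for a (closed) subspace `Y` of `X`: the inclusion map of `Y`
into `X` has the Daugavet property. -/
def IsDaugavetPair {𝕜 X : Type*} [RCLike 𝕜] [SeminormedAddCommGroup X] [NormedSpace 𝕜 X]
    (Y : Submodule 𝕜 X) : Prop :=
  HasDaugavetProperty Y.subtypeL

/-- `X` is a Daugavet space: the identity map of `X` has the Daugavet property. -/
def IsDaugavetSpace (𝕜 X : Type*) [RCLike 𝕜] [SeminormedAddCommGroup X] [NormedSpace 𝕜 X] : Prop :=
  HasDaugavetProperty (ContinuousLinearMap.id 𝕜 X)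

/-- The Radon–Nikodým property of a Banach space `Z`: every countably additive `Z`-valued measure
of bounded variation that is absolutely continuous with respect to a finite positive measure `μ`
is the indefinite Bochner integral of a function in `L¹(μ; Z)`.

The measurable spaces range over `Type`. Nothing is lost: the property is already determined by
Lebesgue measure on the unit interval. -/
def HasRadonNikodymProperty (Z : Type u) [NormedAddCommGroup Z] [NormedSpace ℝ Z] : Prop :=
  ∀ (Ω : Type) [MeasurableSpace Ω] (μ : Measure Ω) [IsFiniteMeasure μ] (G : VectorMeasure Ω Z),
    (∀ E, MeasurableSet E → μ E = 0 → G E = 0) →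
    G.variation Set.univ < ∞ →
    ∃ g : Ω → Z, Integrable g μ ∧ ∀ E, MeasurableSet E → G E = ∫ ω in E, g ω ∂μ

/-- A normed space is reflexive if the canonical embedding into its bidual is surjective. -/
def IsReflexiveSpace (𝕜 E : Type*) [RCLike 𝕜] [SeminormedAddCommGroup E] [NormedSpace 𝕜 E] :
    Prop :=
  Function.Surjective (NormedSpace.inclusionInDoubleDual 𝕜 E)

/-!
For rank-one operators the Daugavet equation has a geometric form in terms of the real structure
(`SliceDaugavet`): every slice of the unit ball contains, for every `z`, a point `x` with
`‖z + x‖` close to `‖z‖ + 1`. In a Daugavet space one can even find `x` in a given slice that works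
for all `z` in a compact set simultaneously (`SliceDaugavet.exists_of_isCompact`).

**Quotients by reflexive subspaces.** Suppose that the points of a slice of the ball of `X`,
cut off by a functional vanishing on `Y`, all come too close to `-x₀ + Y`. Choose successively
`x n` in the slice, almost orthogonal in the sense of `ℓ₁` to
everything chosen before, and `y n ∈ Y` with `‖x₀ + x n + y n‖` too small. By reflexivity the
bounded sequence `y` has a point common to the closed convex hulls of all its tails
(`IsReflexiveSpace.exists_forall_mem_closure_convexHull`), so that some convex combination
`∑ wₙ yₙ` is close to a combination `u` of `y`'s with smaller indices. Hence
`∑ wₙ (x₀ + xₙ + yₙ)` is close to `x₀ + u + ∑ wₙ xₙ`, whose norm is nearly `‖x₀ + u‖ + 1`; this is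
too large.

**Subspaces with a Radon–Nikodým quotient.** The key is that for an operator `T` from a Daugavet
space to a space with the Radon–Nikodým property the points `x` with `‖z + x‖ ≈ ‖z‖ + 1` can be
found with `T x` close to any prescribed value of `T` on the unit ball
(`SliceDaugavet.exists_norm_map_sub_le`). It is applied to `T = (q, f)`, where `q : X → X ⧸ Y` is the
quotient map and `f` a functional; points with `q x ≈ 0` lie near `Y`. For the proof one notes
that the vectors `w` which can be so approximated, for all `z`, form a convex set. If this set is
not dense in the image of the ball, a slice of a neighbourhood of that image is disjoint from it,
and by the Daugavet property each point of the slice is an average of points of the neighbourhood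
whose distance from it is bounded below. Starting from one of them
and iterating, one obtains a bounded martingale, stopped outside the slice, with increments that do
not tend to `0` in `L¹` (`HasRadonNikodymProperty.exists_notMem_convexHull`; the probability space
is provided by the Ionescu-Tulcea theorem). This contradicts the Radon–Nikodým property, under
which bounded martingales are closed by an integrable function
(`HasRadonNikodymProperty.exists_ae_eq_condExp`) and so converge in `L¹` by Lévy's upward theorem.
-/

/-! ### Slices of the unit ball and the Daugavet property -/

/-- The geometric form of the Daugavet property, in terms of the real structure alone: every slice
of the unit ball contains, for every vector `z`, a point `x` for which the triangle inequality
`‖z + J x‖ ≤ ‖z‖ + 1` is almost an equality. -/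
def SliceDaugavet {E F : Type*} [SeminormedAddCommGroup E] [NormedSpace ℝ E]
    [SeminormedAddCommGroup F] (J : E → F) : Prop :=
  ∀ f : E →L[ℝ] ℝ, f ≠ 0 → ∀ z : F, ∀ ε > 0,
    ∃ x, ‖x‖ ≤ 1 ∧ ‖f‖ - ε ≤ f x ∧ ‖z‖ + 1 - ε ≤ ‖z + J x‖

theorem IsDaugavetSpace.sliceDaugavet {𝕜 X : Type*} [RCLike 𝕜] [NormedAddCommGroup X]
    [NormedSpace 𝕜 X] [NormedSpace ℝ X] [IsScalarTower ℝ 𝕜 X] (hX : IsDaugavetSpace 𝕜 X) :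
    SliceDaugavet (id : X → X) := by
  -- It suffices to treat `z ≠ 0`, as the conclusion for some `z` contains the one for `0`.
  suffices H : ∀ f : X →L[ℝ] ℝ, f ≠ 0 → ∀ z : X, z ≠ 0 → ∀ ε > 0,
      ∃ x, ‖x‖ ≤ 1 ∧ ‖f‖ - ε ≤ f x ∧ ‖z‖ + 1 - ε ≤ ‖z + x‖ by
    intro f hf z ε hε
    by_cases hz : z = 0
    · obtain ⟨z', hz'⟩ : ∃ z', f z' ≠ 0 := by
        by_contra! h
        exact hf (ContinuousLinearMap.ext h)
      obtain ⟨x, h1, h2, h3⟩ := H f hf z' (by rintro rfl; simp at hz') ε hε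
      refine ⟨x, h1, h2, ?_⟩
      have := norm_add_le z' x
      simp only [hz, norm_zero, zero_add, id]
      linarith
    · exact H f hf z hz ε hε
  intro f hf z hz ε hε
  have hf0 : 0 < ‖f‖ := norm_pos_iff.2 hf
  have hz0 : 0 < ‖z‖ := norm_pos_iff.2 hz
  set φ : StrongDual 𝕜 X := StrongDual.extendRCLike f with hφ
  have hφn : ‖φ‖ = ‖f‖ := StrongDual.norm_extendRCLike f
  have hφre : ∀ x, RCLike.re (φ x) = f x := fun x => by
    simp [hφ, StrongDual.re_extendRCLike_apply]
  set θ : StrongDual 𝕜 X := ((‖f‖⁻¹ : ℝ) : 𝕜) • φ with hθ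
  have hθn : ‖θ‖ = 1 := by
    rw [hθ, norm_smul, hφn]
    simp [hf0.ne']
  set T : X →L[𝕜] X := θ.smulRight z with hT
  have hTn : ‖T‖ = ‖z‖ := by
    rw [hT, ContinuousLinearMap.norm_smulRight_apply, hθn, one_mul]
  have hTrank : LinearMap.rank (T : X →ₗ[𝕜] X) = 1 := by
    obtain ⟨x, hx⟩ : ∃ x, θ x ≠ 0 := by
      by_contra! h
      rw [ContinuousLinearMap.ext (g := 0) h, norm_zero] at hθn
      exact zero_ne_one hθn
    have : LinearMap.range (T : X →ₗ[𝕜] X) = Submodule.span 𝕜 {z} := by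
      apply le_antisymm
      · rintro _ ⟨y, rfl⟩
        exact Submodule.mem_span_singleton.2 ⟨θ y, rfl⟩
      · rw [Submodule.span_singleton_le_iff_mem]
        refine ⟨(θ x)⁻¹ • x, ?_⟩
        simp [hT, hx]
    rw [LinearMap.rank, this, rank_submodule_eq_one_iff]
    exact ⟨z, Submodule.mem_span_singleton_self z, hz, le_rfl⟩
  have hnorm := hX T hTrank
  rw [hTn] at hnorm
  set δ := min (ε / 2) (ε * ‖z‖ / ‖f‖) with hδ
  have hδ0 : 0 < δ := by positivity
  have hδ1 : δ ≤ ε / 2 := min_le_left _ _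
  have hδ2 : δ ≤ ε * ‖z‖ / ‖f‖ := min_le_right _ _
  obtain ⟨x, hx1, hx2⟩ := ContinuousLinearMap.exists_lt_apply_of_lt_opNorm
    (ContinuousLinearMap.id 𝕜 X + T) (r := 1 + ‖z‖ - δ) (by rw [hnorm]; linarith)
  -- Rotate `x` so that `θ` takes a nonnegative real value.
  obtain ⟨c, hc1, hc2⟩ := RCLike.exists_norm_eq_mul_self (θ x)
  set t : ℝ := ‖θ x‖ with ht
  have hθy : θ (c • x) = (t : 𝕜) := by rw [map_smul, smul_eq_mul, ← hc2]
  have ht1 : t ≤ 1 := by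
    have := θ.le_opNorm x
    rw [hθn] at this
    linarith
  have hy : 1 + ‖z‖ - δ < ‖c • x + (t : 𝕜) • z‖ := by
    have : c • x + (t : 𝕜) • z = c • ((ContinuousLinearMap.id 𝕜 X + T) x) := by
      rw [ht, hc2]
      simp [hT, smul_smul]
    rwa [this, norm_smul, hc1, one_mul]
  have hcx : ‖c • x‖ ≤ 1 := by rw [norm_smul, hc1, one_mul]; exact hx1.le
  have htz : ‖(t : 𝕜) • z‖ = t * ‖z‖ := by
    rw [norm_smul, RCLike.norm_ofReal, abs_of_nonneg (norm_nonneg _)]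
  have ht2 : ‖z‖ - δ ≤ t * ‖z‖ := by
    have := norm_add_le (c • x) ((t : 𝕜) • z)
    rw [htz] at this
    linarith
  refine ⟨c • x, hcx, ?_, ?_⟩
  · have h1 : f (c • x) = ‖f‖ * t := by
      have : φ (c • x) = ((‖f‖ * t : ℝ) : 𝕜) := by
        have h2 : ((‖f‖ : ℝ) : 𝕜) ≠ 0 := by exact_mod_cast hf0.ne'
        have h3 := hθy
        rw [hθ] at h3
        simp only [smul_apply, smul_eq_mul] at h3
        rw [RCLike.ofReal_mul, ← h3, RCLike.ofReal_inv, mul_inv_cancel_left₀ h2]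
      rw [← hφre, this, RCLike.ofReal_re]
    rw [h1]
    rw [le_div_iff₀ hf0] at hδ2
    have : ‖f‖ * (‖z‖ - δ) ≤ ‖f‖ * (t * ‖z‖) := by gcongr
    have : (‖f‖ - ε) * ‖z‖ ≤ (‖f‖ * t) * ‖z‖ := by nlinarith
    exact le_of_mul_le_mul_right this hz0
  · have h1 : c • x + (t : 𝕜) • z = (z + c • x) - ((1 - t : ℝ) : 𝕜) • z := by
      push_cast
      module
    have h2 : ‖((1 - t : ℝ) : 𝕜) • z‖ = (1 - t) * ‖z‖ := by
      rw [norm_smul, RCLike.norm_ofReal, abs_of_nonneg (by linarith)]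
    have h3 := norm_sub_le (z + c • x) (((1 - t : ℝ) : 𝕜) • z)
    rw [← h1, h2] at h3
    linarith

/-- For a contraction `J` the slice condition implies the Daugavet equation for all operators of
rank one. -/
theorem SliceDaugavet.hasDaugavetProperty {𝕜 E F : Type*} [RCLike 𝕜]
    [SeminormedAddCommGroup E] [NormedSpace 𝕜 E] [NormedSpace ℝ E] [IsScalarTower ℝ 𝕜 E]
    [NormedAddCommGroup F] [NormedSpace 𝕜 F] {J : E →L[𝕜] F} (hJ : ‖J‖ ≤ 1)
    (h : SliceDaugavet J) : HasDaugavetProperty J := by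
  intro T hT
  refine le_antisymm ((norm_add_le _ _).trans (by linarith)) ?_
  -- A rank-one operator has the form `T = θ • z`; it can be normalized so that `‖θ‖ = 1`.
  obtain ⟨φ, z, hz, hTφ⟩ : ∃ (φ : StrongDual 𝕜 E) (z : F), z ≠ 0 ∧ T = φ.smulRight z := by
    rw [LinearMap.rank, rank_submodule_eq_one_iff] at hT
    obtain ⟨z, -, hz, hr⟩ := hT
    obtain ⟨g, -, hg⟩ := exists_dual_vector 𝕜 z (norm_ne_zero_iff.2 hz)
    have hz' : ((‖z‖ : ℝ) : 𝕜) ≠ 0 := by exact_mod_cast norm_ne_zero_iff.2 hz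
    refine ⟨((‖z‖ : 𝕜))⁻¹ • (g.comp T), z, hz, ?_⟩
    ext x
    obtain ⟨c, hc⟩ := Submodule.mem_span_singleton.1 (hr ⟨x, rfl⟩)
    replace hc : c • z = T x := hc
    rw [ContinuousLinearMap.smulRight_apply, smul_apply, ContinuousLinearMap.comp_apply, ← hc,
      map_smul, hg, smul_eq_mul, smul_eq_mul, mul_comm c, inv_mul_cancel_left₀ hz']
  have hφ : φ ≠ 0 := by
    rintro rfl
    rw [LinearMap.rank, rank_submodule_eq_one_iff] at hT
    obtain ⟨z', ⟨x, rfl⟩, hz', -⟩ := hT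
    simp [hTφ] at hz'
  have hφ0 : ‖φ‖ ≠ 0 := fun h0 => hφ <| by
    ext x
    have := φ.le_opNorm x
    rw [h0, zero_mul] at this
    simpa using norm_le_zero_iff.1 this
  set θ : StrongDual 𝕜 E := ((‖φ‖⁻¹ : ℝ) : 𝕜) • φ with hθ
  have hθn : ‖θ‖ = 1 := by
    rw [hθ, norm_smul]
    simp [hφ0]
  set w : F := ((‖φ‖ : ℝ) : 𝕜) • z with hw
  have hTθ : T = θ.smulRight w := by
    have : ((‖φ‖ : ℝ) : 𝕜) ≠ 0 := by exact_mod_cast hφ0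
    ext x
    simp only [hTφ, hθ, hw, ContinuousLinearMap.smulRight_apply, smul_apply,
      smul_smul, smul_eq_mul]
    congr 1
    push_cast
    field_simp
  have hTn : ‖T‖ = ‖w‖ := by
    rw [hTθ, ContinuousLinearMap.norm_smulRight_apply, hθn, one_mul]
  set f : E →L[ℝ] ℝ := RCLike.reCLM.comp (θ.restrictScalars ℝ) with hf
  have hfθ : StrongDual.extendRCLike (𝕜 := 𝕜) f = θ := by
    ext x
    simpa [hf, StrongDual.extendRCLike_apply, mul_comm] using RCLike.re_add_im (θ x)
  have hfn : ‖f‖ = 1 := by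
    rw [← hθn, ← hfθ]
    exact (StrongDual.norm_extendRCLike f).symm
  have key : ∀ ε : ℝ, 0 < ε → 1 + ‖w‖ ≤ ‖J + T‖ + (ε + √(2 * ε) * ‖w‖) := by
    intro ε hε
    obtain ⟨x, hx1, hx2, hx3⟩ := h f (by rintro h0; rw [h0, norm_zero] at hfn; simp at hfn) w ε hε
    have hθx : ‖θ x‖ ≤ 1 := (θ.le_opNorm x).trans (by rw [hθn, one_mul]; exact hx1)
    -- A number in the unit disc with real part close to `1` is close to `1`.
    have h1 : ‖1 - θ x‖ ≤ √(2 * ε) := by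
      apply Real.le_sqrt_of_sq_le
      have h2 : ‖θ x‖ ^ 2 ≤ 1 := pow_le_one₀ (norm_nonneg _) hθx
      have h3 : RCLike.re (θ x) = f x := rfl
      rw [RCLike.norm_sq_eq_def] at h2 ⊢
      simp only [map_sub, RCLike.one_re, RCLike.one_im, h3] at h2 ⊢
      rw [hfn] at hx2
      nlinarith
    have h2 : (J + T) x = (w + J x) - (1 - θ x) • w := by
      simp only [hTθ, add_apply, ContinuousLinearMap.smulRight_apply]
      module
    have h3 : ‖(J + T) x‖ ≤ ‖J + T‖ :=
      ((J + T).le_opNorm x).trans (mul_le_of_le_one_right (norm_nonneg _) hx1)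
    have h4 := norm_sub_norm_le (w + J x) ((1 - θ x) • w)
    rw [← h2, norm_smul] at h4
    have h5 : ‖1 - θ x‖ * ‖w‖ ≤ √(2 * ε) * ‖w‖ := by gcongr
    linarith
  rw [hTn]
  have hlim : Filter.Tendsto (fun ε : ℝ => ‖J + T‖ + (ε + √(2 * ε) * ‖w‖))
      (nhdsWithin 0 (Set.Ioi 0)) (nhds ‖J + T‖) := by
    have : Continuous (fun ε : ℝ => ‖J + T‖ + (ε + √(2 * ε) * ‖w‖)) := by fun_prop
    simpa using (this.tendsto 0).mono_left nhdsWithin_le_nhds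
  exact ge_of_tendsto hlim (eventually_nhdsWithin_of_forall fun ε hε => key ε hε)

section

variable {X : Type*} [NormedAddCommGroup X] [NormedSpace ℝ X]

/-- Every slice contains a subslice all of whose points are almost orthogonal to `z` in the sense
of `ℓ₁`. If `x` is one such point and `ψ` norms `z + x`, then `ψ` almost attains its norm at both
`z / ‖z‖` and `x`, and the slice determined by `f + ψ` does the job. -/
theorem SliceDaugavet.exists_subslice (h : SliceDaugavet (id : X → X)) {f : X →L[ℝ] ℝ}
    (hf : f ≠ 0) (z : X) {ε : ℝ} (hε : 0 < ε) :
    ∃ g : X →L[ℝ] ℝ, g ≠ 0 ∧ ∃ δ > 0, ∀ x, ‖x‖ ≤ 1 → ‖g‖ - δ ≤ g x →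
      ‖f‖ - ε ≤ f x ∧ ‖z‖ + 1 - ε ≤ ‖z + x‖ := by
  set δ := min (ε / 4) (1 / 4) with hδ
  have hδ0 : 0 < δ := by positivity
  have hδ1 : δ ≤ ε / 4 := min_le_left _ _
  have hδ2 : δ ≤ 1 / 4 := min_le_right _ _
  obtain ⟨x, hx1, hx2, hx3⟩ := h f hf z δ hδ0
  obtain ⟨ψ, hψ1, hψ2⟩ := exists_dual_vector'' ℝ (z + x)
  have hψ : ∀ y, ψ y ≤ ‖y‖ := fun y =>
    (le_abs_self _).trans ((ψ.le_opNorm y).trans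
      (mul_le_of_le_one_left (norm_nonneg _) hψ1))
  have hfle : ∀ y, ‖y‖ ≤ 1 → f y ≤ ‖f‖ := fun y hy =>
    (le_abs_self _).trans ((f.le_opNorm y).trans (mul_le_of_le_one_right (norm_nonneg _) hy))
  rw [map_add] at hψ2
  simp only [id, RCLike.ofReal_real_eq_id] at hx3 hψ2
  have hψz := hψ z
  have hψx := hψ x
  have hg : ‖f‖ + 1 - 2 * δ ≤ ‖f + ψ‖ := by
    have h1 : (f + ψ) x ≤ ‖f + ψ‖ :=
      (le_abs_self _).trans (((f + ψ).le_opNorm x).trans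
        (mul_le_of_le_one_right (norm_nonneg _) hx1))
    rw [add_apply] at h1
    linarith
  refine ⟨f + ψ, ?_, δ, hδ0, fun y hy1 hy2 => ?_⟩
  · intro h0
    rw [h0, norm_zero] at hg
    linarith [norm_nonneg f]
  · rw [add_apply] at hy2
    have h1 := hfle y hy1
    have h2 := hψ y
    have h3 := hψ (z + y)
    rw [map_add] at h3
    constructor <;> linarith

theorem SliceDaugavet.exists_subslice_finset (h : SliceDaugavet (id : X → X)) {f : X →L[ℝ] ℝ}
    (hf : f ≠ 0) (s : Finset X) {ε : ℝ} (hε : 0 < ε) :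
    ∃ g : X →L[ℝ] ℝ, g ≠ 0 ∧ ∃ δ > 0, ∀ x, ‖x‖ ≤ 1 → ‖g‖ - δ ≤ g x →
      ‖f‖ - ε ≤ f x ∧ ∀ z ∈ s, ‖z‖ + 1 - ε ≤ ‖z + x‖ := by
  classical
  induction s using Finset.induction_on with
  | empty => exact ⟨f, hf, ε, hε, fun x _ h => ⟨h, by simp⟩⟩
  | insert z s _ ih =>
    obtain ⟨g, hg, δ, hδ, H⟩ := ih
    obtain ⟨g', hg', δ', hδ', H'⟩ := h.exists_subslice hg z (lt_min hδ hε)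
    refine ⟨g', hg', δ', hδ', fun x hx1 hx2 => ?_⟩
    obtain ⟨h1, h2⟩ := H' x hx1 hx2
    obtain ⟨h3, h4⟩ := H x hx1 (by linarith [min_le_left δ ε])
    refine ⟨h3, fun w hw => ?_⟩
    rcases Finset.mem_insert.1 hw with rfl | hw
    · linarith [min_le_right δ ε]
    · exact h4 w hw

/-- Every slice contains a point which is almost orthogonal, in the sense of `ℓ₁`, to all vectors
of a given compact set. -/
theorem SliceDaugavet.exists_of_isCompact (h : SliceDaugavet (id : X → X)) {f : X →L[ℝ] ℝ}
    (hf : f ≠ 0) {K : Set X} (hK : IsCompact K) {ε : ℝ} (hε : 0 < ε) :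
    ∃ x, ‖x‖ ≤ 1 ∧ ‖f‖ - ε ≤ f x ∧ ∀ z ∈ K, ‖z‖ + 1 - ε ≤ ‖z + x‖ := by
  obtain ⟨t, ht, hKt⟩ :=
    Metric.totallyBounded_iff.1 hK.totallyBounded (ε / 4) (by positivity)
  obtain ⟨g, hg, δ, hδ, H⟩ := h.exists_subslice_finset hf ht.toFinset (half_pos hε)
  obtain ⟨x, hx1, hx2, -⟩ := h g hg 0 δ hδ
  obtain ⟨h1, h2⟩ := H x hx1 hx2
  refine ⟨x, hx1, by linarith, fun z hz => ?_⟩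
  obtain ⟨y, hy, hzy⟩ := Set.mem_iUnion₂.1 (hKt hz)
  have h3 := h2 y (by simpa using hy)
  rw [Metric.mem_ball, dist_eq_norm] at hzy
  have h4 : ‖y + x‖ ≤ ‖z + x‖ + ‖z - y‖ := by
    have : y + x = (z + x) - (z - y) := by abel
    rw [this]; exact norm_sub_le _ _
  have h5 : ‖z‖ ≤ ‖y‖ + ‖z - y‖ := by
    have := norm_add_le y (z - y)
    rwa [add_sub_cancel] at this
  linarith

end

/-! ### Quotients by reflexive subspaces -/

theorem exists_weights_of_mem_convexHull_range {E : Type*} [AddCommGroup E] [Module ℝ E]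
    {y : ℕ → E} {p : E} (hp : p ∈ convexHull ℝ (Set.range y)) :
    ∃ (N : ℕ) (w : ℕ → ℝ), (∀ n, 0 ≤ w n) ∧ ∑ n ∈ Finset.range N, w n = 1 ∧
      ∑ n ∈ Finset.range N, w n • y n = p := by
  obtain ⟨ι, _, a, v, ha, ha1, hv, hsum⟩ := mem_convexHull_iff_exists_fintype.1 hp
  choose k hk using hv
  have hmaps : ∀ i ∈ (Finset.univ : Finset ι),
      k i ∈ Finset.range (Finset.univ.sup k + 1) := fun i hi =>
    Finset.mem_range.2 (Nat.lt_succ_of_le (Finset.le_sup hi))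
  refine ⟨Finset.univ.sup k + 1, fun n => ∑ i with k i = n, a i,
    fun n => Finset.sum_nonneg fun i _ => ha i, ?_, ?_⟩
  · rw [Finset.sum_fiberwise_of_maps_to hmaps, ha1]
  · rw [← hsum, ← Finset.sum_fiberwise_of_maps_to hmaps]
    refine Finset.sum_congr rfl fun n _ => ?_
    rw [Finset.sum_smul]
    refine Finset.sum_congr rfl fun i hi => ?_
    rw [← hk i, (Finset.mem_filter.1 hi).2]

/-- In a reflexive space a bounded sequence has a point lying in the closed convex hull of each of
its tails: the one representing the limit of the sequence, as elements of the bidual, along a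
free ultrafilter. -/
theorem IsReflexiveSpace.exists_forall_mem_closure_convexHull {𝕜 E : Type*} [RCLike 𝕜]
    [NormedAddCommGroup E] [NormedSpace 𝕜 E] [NormedSpace ℝ E] [IsScalarTower ℝ 𝕜 E]
    (hE : IsReflexiveSpace 𝕜 E) {y : ℕ → E} {M : ℝ} (hy : ∀ n, ‖y n‖ ≤ M) :
    ∃ p, ∀ m, p ∈ closure (convexHull ℝ (Set.range fun n => y (m + n))) := by
  have hlim : ∀ φ : StrongDual 𝕜 E, ∃ a : 𝕜, ‖a‖ ≤ M * ‖φ‖ ∧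
      Filter.Tendsto (fun n => φ (y n)) (Filter.hyperfilter ℕ) (nhds a) := by
    intro φ
    have hmem : ∀ n, φ (y n) ∈ Metric.closedBall (0 : 𝕜) (M * ‖φ‖) := fun n => by
      rw [mem_closedBall_zero_iff, mul_comm]
      exact (φ.le_opNorm _).trans (by gcongr; exact hy n)
    obtain ⟨a, ha, h⟩ := (isCompact_closedBall (0 : 𝕜) (M * ‖φ‖)).ultrafilter_le_nhds
      ((Filter.hyperfilter ℕ).map fun n => φ (y n))
      (Filter.le_principal_iff.2 (Filter.mem_map.2 (Filter.univ_mem' hmem)))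
    exact ⟨a, mem_closedBall_zero_iff.1 ha, h⟩
  choose a ha hat using hlim
  let L : StrongDual 𝕜 E →ₗ[𝕜] 𝕜 :=
    { toFun := a
      map_add' := fun φ ψ => tendsto_nhds_unique (hat (φ + ψ)) ((hat φ).add (hat ψ))
      map_smul' := fun c φ => tendsto_nhds_unique (hat (c • φ)) ((hat φ).const_smul c) }
  obtain ⟨p, hp⟩ := hE (L.mkContinuous M ha)
  have hpa : ∀ φ : StrongDual 𝕜 E, φ p = a φ := fun φ => DFunLike.congr_fun hp φ
  refine ⟨p, fun m => ?_⟩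
  by_contra hpm
  obtain ⟨f, u, hfu, hup⟩ := geometric_hahn_banach_closed_point
    (convex_convexHull ℝ _).closure isClosed_closure hpm
  have h1 := (RCLike.continuous_re.tendsto _).comp (hat (StrongDual.extendRCLike f))
  rw [← hpa, StrongDual.re_extendRCLike_apply] at h1
  refine not_le.2 hup (le_of_tendsto h1 ?_)
  have h2 : ∀ᶠ n in (Filter.hyperfilter ℕ : Filter ℕ), m ≤ n := by
    have : (Filter.hyperfilter ℕ : Filter ℕ) ≤ Filter.atTop := by
      rw [← Nat.cofinite_eq_atTop]
      exact Filter.hyperfilter_le_cofinite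
    exact this (Filter.eventually_ge_atTop m)
  filter_upwards [h2] with n hn
  rw [Function.comp_apply, StrongDual.re_extendRCLike_apply]
  exact (hfu _ (subset_closure (subset_convexHull ℝ _
    ⟨n - m, by simp [Nat.add_sub_cancel' hn]⟩))).le

theorem opNorm_le_opNorm_comp_of_forall_exists_lift {X : Type*} [SeminormedAddCommGroup X]
    [NormedSpace ℝ X] {Q : Type*} [SeminormedAddCommGroup Q] [NormedSpace ℝ Q] (q : X →L[ℝ] Q)
    (hq : ∀ z, ∀ ε > 0, ∃ x, q x = z ∧ ‖x‖ < ‖z‖ + ε) (f : Q →L[ℝ] ℝ) :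
    ‖f‖ ≤ ‖f.comp q‖ := by
  refine f.opNorm_le_bound (norm_nonneg _) fun z => ?_
  refine le_of_forall_pos_le_add fun ε hε => ?_
  set C := ‖f.comp q‖
  have hC : 0 ≤ C := norm_nonneg _
  obtain ⟨x, rfl, hx⟩ := hq z (ε / (C + 1)) (by positivity)
  calc ‖f (q x)‖ ≤ C * ‖x‖ := (f.comp q).le_opNorm x
    _ ≤ C * (‖q x‖ + ε / (C + 1)) := by gcongr
    _ = C * ‖q x‖ + ε * (C / (C + 1)) := by ring
    _ ≤ C * ‖q x‖ + ε := by
      gcongr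
      exact mul_le_of_le_one_right hε.le ((div_le_one (by positivity)).2 (by linarith))

section

variable {𝕜 X : Type*} [RCLike 𝕜] [NormedAddCommGroup X] [NormedSpace 𝕜 X] [NormedSpace ℝ X]
  [IsScalarTower ℝ 𝕜 X]

/-- If the conclusion fails, there are points `x n` of a slice, each almost orthogonal to all
preceding vectors, and `y n ∈ Y` such that all `‖x₀ + x n + y n‖` are small. By reflexivity a convex
combination of some initial segment of the `y n` is close to one of a tail; this turns the
corresponding convex combination of the `x₀ + x n + y n` into a vector that is both long
and short. -/
theorem SliceDaugavet.quotient_of_isReflexiveSpace (h : SliceDaugavet (id : X → X))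
    (Y : Submodule 𝕜 X) [IsClosed (Y : Set X)] (hY : IsReflexiveSpace 𝕜 Y) :
    SliceDaugavet (id : X ⧸ Y → X ⧸ Y) := by
  classical
  intro f hf z ε hε
  by_contra! H
  let q : X →L[ℝ] X ⧸ Y := (Y.mkQL).restrictScalars ℝ
  have hqn : ∀ x, ‖q x‖ ≤ ‖x‖ := fun x => Submodule.Quotient.norm_mk_le Y x
  have hqY : ∀ y : Y, q y = 0 := fun y => (Submodule.Quotient.mk_eq_zero Y).2 y.2
  have hq : ∀ z, ∀ ε > 0, ∃ x, q x = z ∧ ‖x‖ < ‖z‖ + ε := fun z ε hε =>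
    Submodule.Quotient.norm_mk_lt z hε
  obtain ⟨x₀, hx₀, -⟩ := hq z 1 one_pos
  have hfq := opNorm_le_opNorm_comp_of_forall_exists_lift q hq f
  have hfq0 : f.comp q ≠ 0 := fun h0 => by
    rw [h0, norm_zero] at hfq
    exact hf (norm_le_zero_iff.1 hfq)
  set M := ‖z‖ + ‖x₀‖ + 2 with hM
  set R := ‖x₀‖ + M + 1 with hR
  have hstep : ∀ (n : ℕ) (s : Finset X), ∃ (x : X) (y : Y), ‖x‖ ≤ 1 ∧
      ‖x₀ + x + y‖ ≤ ‖z‖ + 1 - ε ∧ ∀ v ∈ Submodule.span ℝ (s : Set X), ‖v‖ ≤ R →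
        ‖v‖ + 1 - ε / 4 * (1 / 2) ^ n ≤ ‖v + x‖ := by
    intro n s
    have hK : IsCompact ((↑) '' Metric.closedBall (0 : Submodule.span ℝ (s : Set X)) R : Set X) :=
      (isCompact_closedBall _ _).image continuous_subtype_val
    have hε' : ε / 4 * (1 / 2) ^ n ≤ ε := by
      have : ((1 : ℝ) / 2) ^ n ≤ 1 := pow_le_one₀ (by norm_num) (by norm_num)
      nlinarith
    obtain ⟨x, hx1, hx2, hx3⟩ := h.exists_of_isCompact hfq0 hK
      (ε := ε / 4 * (1 / 2) ^ n) (by positivity)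
    have h1 := H (q x) ((hqn x).trans hx1)
      (le_trans (by linarith) (show ‖f.comp q‖ - ε / 4 * (1 / 2) ^ n ≤ f (q x) from hx2))
    rw [← hx₀, id, ← map_add] at h1
    obtain ⟨x', hx'1, hx'2⟩ := hq (q (x₀ + x)) _ (sub_pos.2 h1)
    have hmem : x' - (x₀ + x) ∈ Y := by
      rw [← Submodule.Quotient.mk_eq_zero Y]
      exact (map_sub q x' (x₀ + x)).trans (sub_eq_zero.2 hx'1)
    refine ⟨x, ⟨_, hmem⟩, hx1, ?_, fun v hv hvR => hx3 v ⟨⟨v, hv⟩, by simpa using hvR, rfl⟩⟩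
    rw [hx₀] at hx'2
    simp only [add_sub_cancel]
    linarith
  choose X' Y' hX' hXY hX'K using hstep
  -- `σ n` collects `x₀` and the vectors chosen before stage `n`.
  obtain ⟨σ, hσ0, hσ⟩ : ∃ σ : ℕ → Finset X, σ 0 = {x₀} ∧
      ∀ n, σ (n + 1) = insert (X' n (σ n)) (insert (Y' n (σ n) : X) (σ n)) :=
    ⟨fun n => Nat.rec {x₀} (fun n s => insert (X' n s) (insert (Y' n s : X) s)) n, rfl,
      fun _ => rfl⟩
  have hσmono : Monotone σ := monotone_nat_of_le_succ fun n => by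
    rw [hσ]
    exact (Finset.subset_insert _ _).trans (Finset.subset_insert _ _)
  let x : ℕ → X := fun n => X' n (σ n)
  let y : ℕ → Y := fun n => Y' n (σ n)
  have hxσ : ∀ {i n : ℕ}, i < n → x i ∈ Submodule.span ℝ (σ n : Set X) := fun {i n} hin => by
    have h1 : x i ∈ σ (i + 1) := by rw [hσ]; exact Finset.mem_insert_self _ _
    exact Submodule.subset_span (hσmono (Nat.succ_le_of_lt hin) h1)
  have hyσ : ∀ {i n : ℕ}, i < n → (y i : X) ∈ Submodule.span ℝ (σ n : Set X) := fun {i n} hin => by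
    have h1 : (y i : X) ∈ σ (i + 1) := by
      rw [hσ]; exact Finset.mem_insert_of_mem (Finset.mem_insert_self _ _)
    exact Submodule.subset_span (hσmono (Nat.succ_le_of_lt hin) h1)
  have hx₀σ : ∀ n, x₀ ∈ Submodule.span ℝ (σ n : Set X) := fun n =>
    Submodule.subset_span (hσmono (Nat.zero_le n) (by simp [hσ0]))
  have hyM : ∀ n, ‖y n‖ ≤ M := fun n => by
    have h1 := hXY n (σ n)
    have h2 := hX' n (σ n)
    have h3 : ‖(y n : X)‖ ≤ ‖x₀ + x n + y n‖ + ‖x₀ + x n‖ := by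
      have := norm_sub_le (x₀ + x n + y n) (x₀ + x n)
      rwa [add_sub_cancel_left] at this
    have h4 := norm_add_le x₀ (x n)
    change ‖(y n : X)‖ ≤ M
    change ‖x₀ + x n + y n‖ ≤ _ at h1
    change ‖x n‖ ≤ 1 at h2
    linarith
  obtain ⟨p, hp⟩ := hY.exists_forall_mem_closure_convexHull hyM
  obtain ⟨u, hu, hpu⟩ := Metric.mem_closure_iff.1 (hp 0) (ε / 8) (by positivity)
  simp only [zero_add] at hu
  obtain ⟨m, b, hb0, hb1, hbu⟩ := exists_weights_of_mem_convexHull_range hu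
  obtain ⟨v, hv, hpv⟩ := Metric.mem_closure_iff.1 (hp m) (ε / 8) (by positivity)
  obtain ⟨N, w, hw0, hw1, hwv⟩ := exists_weights_of_mem_convexHull_range hv
  have huv : ‖(v : X) - u‖ < ε / 4 := by
    have : ‖v - u‖ < ε / 4 := by
      rw [← dist_eq_norm]
      have := dist_triangle_left v u p
      linarith
    exact this
  have huM : ‖(u : X)‖ ≤ M := by
    have : ‖u‖ ≤ M := by
      rw [← hbu]
      calc ‖∑ n ∈ Finset.range m, b n • y n‖ ≤ ∑ n ∈ Finset.range m, ‖b n • y n‖ :=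
            norm_sum_le _ _
        _ ≤ ∑ n ∈ Finset.range m, b n * M := by
            gcongr with n hn
            rw [norm_smul, Real.norm_of_nonneg (hb0 n)]
            gcongr
            · exact hb0 n
            · exact hyM n
        _ = M := by rw [← Finset.sum_mul, hb1, one_mul]
    exact this
  have huσ : ∀ {n : ℕ}, m ≤ n → (u : X) ∈ Submodule.span ℝ (σ n : Set X) := fun {n} hn => by
    rw [← hbu]
    push_cast
    exact Submodule.sum_mem _ fun i hi => Submodule.smul_mem _ _
      (hyσ ((Finset.mem_range.1 hi).trans_le hn))
  have hlong : ∀ k ≤ N, ‖x₀ + u‖ + ∑ j ∈ Finset.range k, w j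
      - ∑ j ∈ Finset.range k, ε / 4 * (1 / 2) ^ j ≤
        ‖x₀ + u + ∑ j ∈ Finset.range k, w j • x (m + j)‖ := by
    intro k hk
    induction k with
    | zero => simp
    | succ k ih =>
      replace ih := ih (by omega)
      set s := x₀ + u + ∑ j ∈ Finset.range k, w j • x (m + j) with hs
      have hw1' : ∀ i ≤ N, ∑ j ∈ Finset.range i, w j ≤ 1 := fun i hi => by
        rw [← hw1]
        exact Finset.sum_le_sum_of_subset_of_nonneg (Finset.range_mono hi) fun j _ _ => hw0 j
      have hwk : w k ≤ 1 := (Finset.single_le_sum (fun j _ => hw0 j)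
        (Finset.self_mem_range_succ k)).trans (hw1' _ hk)
      have hsR : ‖s‖ ≤ R := by
        have h1 : ‖∑ j ∈ Finset.range k, w j • x (m + j)‖ ≤ ∑ j ∈ Finset.range k, w j := by
          refine norm_sum_le_of_le _ fun j _ => ?_
          rw [norm_smul, Real.norm_of_nonneg (hw0 j)]
          exact mul_le_of_le_one_right (hw0 j) (hX' _ _)
        have h2 := hw1' k (by omega)
        have h3 := norm_add_le (x₀ + (u : X)) (∑ j ∈ Finset.range k, w j • x (m + j))
        have h4 := norm_add_le x₀ (u : X)
        linarith
      have hsσ : s ∈ Submodule.span ℝ (σ (m + k) : Set X) :=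
        Submodule.add_mem _ (Submodule.add_mem _ (hx₀σ _) (huσ (by omega)))
          (Submodule.sum_mem _ fun j hj => Submodule.smul_mem _ _
            (hxσ (by have := Finset.mem_range.1 hj; omega)))
      have h1 : ‖s‖ + 1 - ε / 4 * (1 / 2) ^ (m + k) ≤ ‖s + x (m + k)‖ := hX'K _ _ s hsσ hsR
      have h2 : ε / 4 * (1 / 2) ^ (m + k) ≤ ε / 4 * (1 / 2) ^ k :=
        mul_le_mul_of_nonneg_left
          (pow_le_pow_of_le_one (by norm_num) (by norm_num) (by omega)) (by positivity)
      have h3 : ‖s + x (m + k)‖ ≤ ‖s + w k • x (m + k)‖ + (1 - w k) := by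
        have h4 : s + x (m + k) = (s + w k • x (m + k)) + (1 - w k) • x (m + k) := by module
        rw [h4]
        refine (norm_add_le _ _).trans (add_le_add_right ?_ _)
        rw [norm_smul, Real.norm_of_nonneg (by linarith)]
        exact mul_le_of_le_one_right (by linarith) (hX' _ _)
      rw [Finset.sum_range_succ, Finset.sum_range_succ, Finset.sum_range_succ,
        ← add_assoc (x₀ + (u : X)), ← hs]
      linarith
  have hgeom : ∑ j ∈ Finset.range N, ε / 4 * (1 / 2 : ℝ) ^ j ≤ ε / 2 := by
    rw [← Finset.mul_sum]
    have := sum_geometric_two_le N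
    nlinarith
  have hshort : ‖x₀ + v + ∑ j ∈ Finset.range N, w j • x (m + j)‖ ≤ ‖z‖ + 1 - ε := by
    have h1 : x₀ + v + ∑ j ∈ Finset.range N, w j • x (m + j) =
        ∑ j ∈ Finset.range N, w j • (x₀ + x (m + j) + y (m + j)) := by
      simp only [smul_add, Finset.sum_add_distrib, ← Finset.sum_smul, hw1, one_smul]
      rw [← hwv]
      push_cast
      abel
    rw [h1]
    calc ‖∑ j ∈ Finset.range N, w j • (x₀ + x (m + j) + y (m + j))‖
        ≤ ∑ j ∈ Finset.range N, w j * (‖z‖ + 1 - ε) := by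
          refine norm_sum_le_of_le _ fun j _ => ?_
          rw [norm_smul, Real.norm_of_nonneg (hw0 j)]
          exact mul_le_mul_of_nonneg_left (hXY _ _) (hw0 j)
      _ = ‖z‖ + 1 - ε := by rw [← Finset.sum_mul, hw1, one_mul]
  have h1 := hlong N le_rfl
  have h2 : ‖z‖ ≤ ‖x₀ + u‖ := by
    have := hqn (x₀ + u)
    rwa [map_add, hqY, add_zero, hx₀] at this
  have h3 : ‖x₀ + u + ∑ j ∈ Finset.range N, w j • x (m + j)‖ ≤
      ‖x₀ + v + ∑ j ∈ Finset.range N, w j • x (m + j)‖ + ‖(v : X) - u‖ := by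
    have h4 : x₀ + (u : X) + ∑ j ∈ Finset.range N, w j • x (m + j) =
      (x₀ + v + ∑ j ∈ Finset.range N, w j • x (m + j)) - (v - u) := by abel
    rw [h4]
    exact norm_sub_le _ _
  rw [hw1] at h1
  linarith

end

/-! ### Bounded martingales in spaces with the Radon–Nikodým property -/

section

variable {Ω : Type*} {m0 : MeasurableSpace Ω} {μ : Measure Ω} [IsFiniteMeasure μ]
  {Z : Type*} [NormedAddCommGroup Z] [NormedSpace ℝ Z] [CompleteSpace Z]

/-- Lévy's upward theorem in `L¹` for functions with values in a Banach space. It follows from the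
real case, which yields it for indicators, by density. -/
theorem tendsto_eLpNorm_condExp_sub_of_iSup_eq {ℱ : Filtration ℕ m0} (hℱ : ⨆ n, ℱ n = m0)
    {g : Ω → Z} (hg : Integrable g μ) :
    Filter.Tendsto (fun n => eLpNorm (μ[g | ℱ n] - g) 1 μ) Filter.atTop (nhds 0) := by
  refine Integrable.induction
    (fun g => Filter.Tendsto (fun n => eLpNorm (μ[g | ℱ n] - g) 1 μ) Filter.atTop (nhds 0))
    ?_ ?_ ?_ ?_ hg
  · intro c s hs _
    set u : Ω → ℝ := s.indicator fun _ => 1 with hu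
    have hui : Integrable u μ := (integrable_const 1).indicator hs
    have h1 := tendsto_eLpNorm_condExp (μ := μ) (ℱ := ℱ) u
    rw [hℱ, condExp_of_stronglyMeasurable le_rfl
      (stronglyMeasurable_const.indicator hs) hui] at h1
    let A : ℝ →L[ℝ] Z := ContinuousLinearMap.toSpanSingleton ℝ c
    have hA : (s.indicator fun _ => c) = A ∘ u := by
      ext ω
      by_cases hω : ω ∈ s <;> simp [A, hu, hω]
    have h2 : ∀ n, eLpNorm (μ[s.indicator fun _ => c | ℱ n] - s.indicator fun _ => c) 1 μ
        ≤ ‖c‖ₑ * eLpNorm (μ[u | ℱ n] - u) 1 μ := by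
      intro n
      have h3 : μ[s.indicator fun _ => c | ℱ n] - (s.indicator fun _ => c)
          =ᵐ[μ] fun ω => A ((μ[u | ℱ n] - u) ω) := by
        filter_upwards [A.comp_condExp_comm (m := ℱ n) hui] with ω hω
        rw [hA, Pi.sub_apply, ← hω, Pi.sub_apply, map_sub]
        rfl
      rw [eLpNorm_congr_ae h3, ← ofReal_norm]
      refine eLpNorm_le_mul_eLpNorm_of_ae_le_mul (Filter.Eventually.of_forall fun ω => ?_) 1
      rw [ContinuousLinearMap.toSpanSingleton_apply, norm_smul, mul_comm]
    have h3 : Filter.Tendsto (fun n => ‖c‖ₑ * eLpNorm (μ[u | ℱ n] - u) 1 μ)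
        Filter.atTop (nhds 0) := by
      simpa using ENNReal.Tendsto.const_mul h1 (Or.inr enorm_ne_top)
    exact tendsto_of_tendsto_of_tendsto_of_le_of_le tendsto_const_nhds h3
      (fun _ => zero_le) h2
  · intro f g _ hf hg hPf hPg
    have h1 := hPf.add hPg
    rw [add_zero] at h1
    refine tendsto_of_tendsto_of_tendsto_of_le_of_le tendsto_const_nhds h1
      (fun _ => zero_le) fun n => ?_
    have h2 : μ[f + g | ℱ n] - (f + g) =ᵐ[μ] (μ[f | ℱ n] - f) + (μ[g | ℱ n] - g) := by
      filter_upwards [condExp_add hf hg (ℱ n)] with ω hω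
      simp only [Pi.sub_apply, Pi.add_apply, hω]
      abel
    rw [eLpNorm_congr_ae h2]
    exact eLpNorm_add_le (integrable_condExp.sub hf).1 (integrable_condExp.sub hg).1 le_rfl
  · -- Conditional expectations are contractions of `L¹`.
    refine isClosed_of_closure_subset fun f hf => ENNReal.tendsto_nhds_zero.2 fun ε hε => ?_
    obtain ⟨h, hh, hfh⟩ := EMetric.mem_closure_iff.1 hf (ε / 3)
      (ENNReal.div_pos hε.ne' (by norm_num))
    have hfi : Integrable f μ := L1.integrable_coeFn f
    have hhi : Integrable h μ := L1.integrable_coeFn h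
    let d : Ω → Z := fun ω => f ω - h ω
    have hd : Integrable d μ := hfi.sub hhi
    replace hfh : eLpNorm d 1 μ < ε / 3 := by rwa [Lp.edist_def] at hfh
    filter_upwards [ENNReal.tendsto_nhds_zero.1 hh (ε / 3)
      (ENNReal.div_pos hε.ne' (by norm_num))] with n hn
    have h1 : μ[f | ℱ n] - ⇑f =ᵐ[μ] (μ[d | ℱ n] + (μ[h | ℱ n] - ⇑h)) - d := by
      filter_upwards [condExp_sub hfi hhi (ℱ n)] with ω hω
      have hω' : (μ[d | ℱ n]) ω = (μ[f | ℱ n]) ω - (μ[h | ℱ n]) ω := hω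
      simp only [Pi.sub_apply, Pi.add_apply, hω', d]
      abel
    rw [eLpNorm_congr_ae h1]
    calc _ ≤ eLpNorm (μ[d | ℱ n] + (μ[h | ℱ n] - ⇑h)) 1 μ + eLpNorm d 1 μ :=
          eLpNorm_sub_le (integrable_condExp.add (integrable_condExp.sub hhi)).1
            hd.1 le_rfl
      _ ≤ eLpNorm (μ[d | ℱ n]) 1 μ + eLpNorm (μ[h | ℱ n] - ⇑h) 1 μ
          + eLpNorm d 1 μ := by
        gcongr
        exact eLpNorm_add_le integrable_condExp.1 (integrable_condExp.sub hhi).1 le_rfl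
      _ ≤ ε / 3 + ε / 3 + ε / 3 := by
        gcongr
        exact (eLpNorm_condExp_le_eLpNorm _ le_rfl).trans hfh.le
      _ = ε := ENNReal.add_thirds ε
  · intro f g hfg _ hPf
    refine hPf.congr fun n => eLpNorm_congr_ae ?_
    filter_upwards [hfg, condExp_congr_ae (m := ℱ n) hfg] with ω h1 h2
    simp [h1, h2]

end

/-- A bounded martingale with values in a space with the Radon–Nikodým property is closed by an
integrable function. The vector measure whose density is taken is `E ↦ lim ∫ ω in E, f n ω`; the
sets for which the limit exists form a Dynkin system containing all `ℱ n`. -/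
theorem HasRadonNikodymProperty.exists_ae_eq_condExp {Z : Type*} [NormedAddCommGroup Z]
    [NormedSpace ℝ Z] [CompleteSpace Z] (hZ : HasRadonNikodymProperty Z) {Ω : Type}
    {m0 : MeasurableSpace Ω} {μ : Measure Ω} [IsFiniteMeasure μ] {ℱ : Filtration ℕ m0}
    (hℱ : ⨆ n, ℱ n = m0) {f : ℕ → Ω → Z} (hf : Martingale f ℱ μ) {C : ℝ}
    (hC : ∀ n ω, ‖f n ω‖ ≤ C) :
    ∃ g, Integrable g μ ∧ ∀ n, f n =ᵐ[μ] μ[g | ℱ n] := by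
  classical
  have hbound : ∀ E n, ‖∫ ω in E, f n ω ∂μ‖ ≤ C * μ.real E := fun E n =>
    norm_setIntegral_le_of_norm_le_const (measure_lt_top μ E) fun ω _ => hC n ω
  have hadapted : ∀ n E, MeasurableSet[ℱ n] E →
      Filter.Tendsto (fun k => ∫ ω in E, f k ω ∂μ) Filter.atTop (nhds (∫ ω in E, f n ω ∂μ)) := by
    intro n E hE
    refine tendsto_const_nhds.congr' ?_
    filter_upwards [Filter.eventually_ge_atTop n] with k hk
    exact hf.setIntegral_eq hk hE
  have hunion : ∀ (E : ℕ → Set Ω) (a : ℕ → Z), (∀ i, MeasurableSet (E i)) →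
      Pairwise (Function.onFun Disjoint E) →
      (∀ i, Filter.Tendsto (fun n => ∫ ω in E i, f n ω ∂μ) Filter.atTop (nhds (a i))) →
      Filter.Tendsto (fun n => ∫ ω in ⋃ i, E i, f n ω ∂μ) Filter.atTop (nhds (∑' i, a i)) ∧
        Summable a := by
    intro E a hE hdisj ha
    have hsum : Summable fun i => C * μ.real (E i) :=
      (ENNReal.summable_toReal (by
        rw [← measure_iUnion hdisj hE]; exact measure_ne_top _ _)).mul_left C
    refine ⟨?_, hsum.of_norm_bounded fun i =>
      le_of_tendsto (ha i).norm (Filter.Eventually.of_forall fun n => hbound _ n)⟩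
    have h1 : ∀ n, ∫ ω in ⋃ i, E i, f n ω ∂μ = ∑' i, ∫ ω in E i, f n ω ∂μ := fun n =>
      integral_iUnion hE hdisj (hf.integrable n).integrableOn
    simp_rw [h1]
    exact tendsto_tsum_of_dominated_convergence hsum ha
      (Filter.Eventually.of_forall fun n i => hbound _ n)
  have hlim : ∀ E, MeasurableSet E →
      ∃ a, Filter.Tendsto (fun n => ∫ ω in E, f n ω ∂μ) Filter.atTop (nhds a) := by
    refine MeasurableSpace.induction_on_inter (s := {E | ∃ n, MeasurableSet[ℱ n] E})
      (hℱ.symm.trans (MeasurableSpace.measurableSpace_iSup_eq _)) ?_ ?_ ?_ ?_ ?_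
    · rintro s ⟨n, hs⟩ t ⟨k, ht⟩ -
      exact ⟨max n k, (ℱ.mono (le_max_left n k) _ hs).inter (ℱ.mono (le_max_right n k) _ ht)⟩
    · exact ⟨0, by simp⟩
    · rintro E ⟨n, hE⟩
      exact ⟨_, hadapted n E hE⟩
    · rintro E hE ⟨a, ha⟩
      refine ⟨(∫ ω in Set.univ, f 0 ω ∂μ) - a, ((hadapted 0 _ MeasurableSet.univ).sub ha).congr
        fun n => ?_⟩
      rw [sub_eq_iff_eq_add', integral_add_compl hE (hf.integrable n), setIntegral_univ]
    · intro E hdisj hE h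
      choose a ha using h
      exact ⟨_, (hunion E a hE hdisj ha).1⟩
  let G : VectorMeasure Ω Z :=
    { measureOf' := fun E => if h : MeasurableSet E then (hlim E h).choose else 0
      empty' := by
        rw [dif_pos MeasurableSet.empty]
        exact tendsto_nhds_unique (hlim ∅ MeasurableSet.empty).choose_spec (by simp)
      not_measurable' := fun E hE => dif_neg hE
      m_iUnion' := fun E hE hdisj => by
        have h := hunion E _ hE hdisj fun i => (hlim (E i) (hE i)).choose_spec
        simp only [hE, MeasurableSet.iUnion hE, dif_pos]
        rw [tendsto_nhds_unique (hlim _ (MeasurableSet.iUnion hE)).choose_spec h.1]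
        exact h.2.hasSum }
  have hG : ∀ E, MeasurableSet E →
      Filter.Tendsto (fun n => ∫ ω in E, f n ω ∂μ) Filter.atTop (nhds (G E)) := fun E hE => by
    have : G E = (hlim E hE).choose := dif_pos hE
    rw [this]
    exact (hlim E hE).choose_spec
  have hGbound : ∀ E, MeasurableSet E → ‖G E‖ ≤ C * μ.real E := fun E hE =>
    le_of_tendsto (hG E hE).norm (Filter.Eventually.of_forall fun n => hbound E n)
  obtain ⟨g, hg, hGg⟩ := hZ Ω μ G
    (fun E hE h0 => by
      have := hGbound E hE
      rw [measureReal_def, h0] at this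
      simpa using this)
    (by
      have h1 : G.variation ≤ C.toNNReal • μ := by
        refine VectorMeasure.variation_le_of_forall_enorm_le fun E hE => ?_
        rw [← ofReal_norm]
        refine (ENNReal.ofReal_le_ofReal (hGbound E hE)).trans ?_
        rw [ENNReal.ofReal_mul' measureReal_nonneg, ofReal_measureReal]
        rfl
      exact (h1 _).trans_lt (measure_lt_top _ _))
  refine ⟨g, hg, fun n => ?_⟩
  refine ae_eq_condExp_of_forall_setIntegral_eq (ℱ.le n) hg
    (fun E _ _ => (hf.integrable n).integrableOn) (fun E hE _ => ?_)
    (hf.stronglyMeasurable n).aestronglyMeasurable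
  rw [← hGg E (ℱ.le n E hE)]
  exact tendsto_nhds_unique (hadapted n E hE) (hG E (ℱ.le n E hE))

theorem HasRadonNikodymProperty.tendsto_eLpNorm_succ_sub {Z : Type*} [NormedAddCommGroup Z]
    [NormedSpace ℝ Z] [CompleteSpace Z] (hZ : HasRadonNikodymProperty Z) {Ω : Type}
    {m0 : MeasurableSpace Ω} {μ : Measure Ω} [IsFiniteMeasure μ] {ℱ : Filtration ℕ m0}
    (hℱ : ⨆ n, ℱ n = m0) {f : ℕ → Ω → Z} (hf : Martingale f ℱ μ) {C : ℝ}
    (hC : ∀ n ω, ‖f n ω‖ ≤ C) :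
    Filter.Tendsto (fun n => eLpNorm (f (n + 1) - f n) 1 μ) Filter.atTop (nhds 0) := by
  obtain ⟨g, hg, hfg⟩ := hZ.exists_ae_eq_condExp hℱ hf hC
  have h0 := tendsto_eLpNorm_condExp_sub_of_iSup_eq hℱ hg
  have h1 := (h0.comp (Filter.tendsto_add_atTop_nat 1)).add h0
  rw [add_zero] at h1
  refine tendsto_of_tendsto_of_tendsto_of_le_of_le tendsto_const_nhds h1 (fun _ => zero_le)
    fun n => ?_
  have h2 : f (n + 1) - f n =ᵐ[μ] (μ[g | ℱ (n + 1)] - g) - (μ[g | ℱ n] - g) := by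
    filter_upwards [hfg n, hfg (n + 1)] with ω h3 h4
    simp [h3, h4]
  rw [eLpNorm_congr_ae h2]
  exact eLpNorm_sub_le (integrable_condExp.sub hg).1 (integrable_condExp.sub hg).1 le_rfl

/-! ### Slices that are not averages of distant points -/

theorem exists_measure_integral_eq_of_mem_convexHull {Z : Type*} [NormedAddCommGroup Z]
    [NormedSpace ℝ Z] [CompleteSpace Z] {A : Set Z} {w : Z} (hw : w ∈ convexHull ℝ A) :
    ∃ (ν : Measure ℕ) (c : ℕ → Z), IsProbabilityMeasure ν ∧ (∀ j, c j ∈ A) ∧ ∫ j, c j ∂ν = w := by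
  classical
  obtain ⟨ι, _, a, z, ha, ha1, hz, hsum⟩ := mem_convexHull_iff_exists_fintype.1 hw
  obtain ⟨z₀, hz₀⟩ : A.Nonempty := convexHull_nonempty_iff.1 ⟨w, hw⟩
  let e := Fintype.equivFin ι
  let c : ℕ → Z := fun j => if h : j < Fintype.card ι then z (e.symm ⟨j, h⟩) else z₀
  have hce : ∀ i, c (e i) = z i := fun i => by simp [c]
  refine ⟨∑ i, ENNReal.ofReal (a i) • Measure.dirac (e i : ℕ), c, ⟨?_⟩, fun j => ?_, ?_⟩
  · simp only [Measure.coe_finsetSum, Finset.sum_apply, Measure.smul_apply, measure_univ,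
      smul_eq_mul, mul_one]
    rw [← ENNReal.ofReal_sum_of_nonneg fun i _ => ha i, ha1, ENNReal.ofReal_one]
  · by_cases h : j < Fintype.card ι
    · simp only [c, dif_pos h, hz]
    · simpa only [c, dif_neg h] using hz₀
  · rw [integral_finsetSum_measure fun i _ =>
      (integrable_dirac (by finiteness)).smul_measure ENNReal.ofReal_ne_top]
    simp only [integral_smul_measure, integral_dirac, ENNReal.toReal_ofReal (ha _), hce, hsum]

theorem iSup_piLE_nat {X : ℕ → Type*} [∀ n, MeasurableSpace (X n)] :
    ⨆ n, (Filtration.piLE (X := X) : Filtration ℕ MeasurableSpace.pi) n = MeasurableSpace.pi := by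
  refine le_antisymm (iSup_le fun n => Filtration.piLE.le n) (iSup_mono fun n => ?_)
  rw [Filtration.piLE_eq_comap_frestrictLe]
  have h : (fun x : (n : ℕ) → X n => x n) =
      (fun y : (i : Finset.Iic n) → X i => y ⟨n, by simp⟩) ∘ Preorder.frestrictLe n := rfl
  rw [h, ← MeasurableSpace.comap_comp]
  exact MeasurableSpace.comap_mono
    (measurable_pi_apply (X := fun i : Finset.Iic n => X i) ⟨n, by simp⟩).comap_le

section

variable {Z : Type*} (w₀ : Z) (c : Z → ℕ → Z)

/-- The position at time `n` of the walk in `Z` which starts at `w₀` and whose step from `w` at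
time `n` leads to the point `c w (ω (n + 1))`. -/
def walk : ℕ → (ℕ → ℕ) → Z
  | 0, _ => w₀
  | n + 1, ω => c (walk n ω) (ω (n + 1))

variable {w₀ c}

theorem walk_congr {n : ℕ} {ω ω' : ℕ → ℕ} (h : ∀ i ≤ n, ω i = ω' i) :
    walk w₀ c n ω = walk w₀ c n ω' := by
  induction n with
  | zero => rfl
  | succ n ih => rw [walk, walk, ih fun i hi => h i (by omega), h (n + 1) le_rfl]

variable (w₀ c)

/-- The position of the walk as a function of the choices made up to time `n`. -/
def walkOfHistory (n : ℕ) (h : (i : Finset.Iic n) → ℕ) : Z :=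
  walk w₀ c n fun i => if hi : i ∈ Finset.Iic n then h ⟨i, hi⟩ else 0

theorem walkOfHistory_frestrictLe (n : ℕ) (ω : ℕ → ℕ) :
    walkOfHistory w₀ c n (Preorder.frestrictLe n ω) = walk w₀ c n ω :=
  walk_congr fun i hi => by simp [hi]

/-- The law of the choice made by the walk at time `n + 1`, given its past: it depends on the
position `w` at time `n` only and is given by `ν w`. -/
noncomputable def walkKernel (ν : Z → Measure ℕ) (n : ℕ) :
    ProbabilityTheory.Kernel ((i : Finset.Iic n) → ℕ) ℕ :=
  ProbabilityTheory.Kernel.ofFunOfCountable fun h => ν (walkOfHistory w₀ c n h)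

instance (ν : Z → Measure ℕ) [hν : ∀ w, IsProbabilityMeasure (ν w)] (n : ℕ) :
    ProbabilityTheory.IsMarkovKernel (walkKernel w₀ c ν n) :=
  ⟨fun _ => hν _⟩

/-- The law, on the space of all sequences of choices, of the walk with transitions `ν`. -/
noncomputable def walkMeasure (ν : Z → Measure ℕ) [∀ w, IsProbabilityMeasure (ν w)] :
    Measure (ℕ → ℕ) :=
  ProbabilityTheory.Kernel.traj (X := fun _ => ℕ) (walkKernel w₀ c ν) 0 fun _ => 0

instance (ν : Z → Measure ℕ) [∀ w, IsProbabilityMeasure (ν w)] :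
    IsProbabilityMeasure (walkMeasure w₀ c ν) := by
  unfold walkMeasure
  infer_instance

/-- A bounded walk in which every point is the mean of its successors is a martingale. -/
theorem martingale_walk [NormedAddCommGroup Z] [NormedSpace ℝ Z] [CompleteSpace Z]
    (ν : Z → Measure ℕ) [∀ w, IsProbabilityMeasure (ν w)]
    (hν : ∀ w, ∫ j, c w j ∂ν w = w) {R : ℝ} (hR : ∀ n ω, ‖walk w₀ c n ω‖ ≤ R) :
    Martingale (walk w₀ c) (Filtration.piLE (X := fun _ : ℕ => ℕ)) (walkMeasure w₀ c ν) := by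
  have hmeas : ∀ n, StronglyMeasurable[Filtration.piLE (X := fun _ : ℕ => ℕ) n]
      (walk w₀ c n) := fun n => by
    have h1 : walk w₀ c n = walkOfHistory w₀ c n ∘ Preorder.frestrictLe n :=
      funext fun ω => (walkOfHistory_frestrictLe w₀ c n ω).symm
    rw [h1, Filtration.piLE_eq_comap_frestrictLe]
    exact StronglyMeasurable.of_discrete.comp_measurable (comap_measurable _)
  have hsm : ∀ n, StronglyMeasurable (walk w₀ c n) := fun n =>
    (hmeas n).mono (Filtration.piLE.le n)
  have hint : ∀ n (μ : Measure (ℕ → ℕ)) [IsFiniteMeasure μ], Integrable (walk w₀ c n) μ :=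
    fun n μ _ => Integrable.of_bound (hsm n).aestronglyMeasurable R
      (Filter.Eventually.of_forall fun ω => hR n ω)
  have hstep : ∀ n, (walkMeasure w₀ c ν)[walk w₀ c (n + 1) | Filtration.piLE n]
      =ᵐ[walkMeasure w₀ c ν] walk w₀ c n := by
    intro n
    refine (ProbabilityTheory.Kernel.condExp_traj (Nat.zero_le n) (hint _ _)).trans
      (Filter.Eventually.of_forall fun ω => ?_)
    set h := Preorder.frestrictLe (π := fun _ => ℕ) n ω with hh
    have h1 : ∀ y : ℕ → ℕ, walk w₀ c (n + 1) (Function.updateFinset y (Finset.Iic n) h) =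
        c (walk w₀ c n ω) (y (n + 1)) := fun y => by
      have h2 : walk w₀ c n (Function.updateFinset y (Finset.Iic n) h) = walk w₀ c n ω :=
        walk_congr fun i hi => by simp [Function.updateFinset, hi, hh]
      rw [walk, h2]
      simp [Function.updateFinset]
    change ∫ y, walk w₀ c (n + 1) y ∂ProbabilityTheory.Kernel.traj (X := fun _ => ℕ)
      (walkKernel w₀ c ν) n h = walk w₀ c n ω
    rw [ProbabilityTheory.Kernel.integral_traj _ (hsm _).aestronglyMeasurable]
    simp_rw [h1]
    rw [← integral_map (φ := fun y : ℕ → ℕ => y (n + 1)) (f := c (walk w₀ c n ω))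
      (measurable_pi_apply _).aemeasurable StronglyMeasurable.of_discrete.aestronglyMeasurable,
      ← ProbabilityTheory.Kernel.map_apply _ (measurable_pi_apply _),
      ProbabilityTheory.Kernel.map_traj_succ_self]
    change ∫ j, c (walk w₀ c n ω) j ∂ν (walkOfHistory w₀ c n h) = walk w₀ c n ω
    rw [hh, walkOfHistory_frestrictLe, hν]
  exact martingale_nat hmeas (fun n => hint n _) fun n => (hstep n).symm

end

/-- In a space with the Radon–Nikodým property, a nonempty slice of a bounded set `C` contains a
point which is not a convex combination of points of `C` at distance at least `ε` from it.
Otherwise there would be a walk in `C` which makes jumps of size at least `ε` as long as it stays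
in the slice, is stopped when it leaves the slice, and is a martingale. As `ψ` is bounded on `C` and
its mean along the walk is constant, the walk stays in the slice forever with positive probability,
which is incompatible with the convergence of bounded martingales. -/
theorem HasRadonNikodymProperty.exists_notMem_convexHull {Z : Type*} [NormedAddCommGroup Z]
    [NormedSpace ℝ Z] [CompleteSpace Z] (hZ : HasRadonNikodymProperty Z) {C : Set Z}
    (hC : Bornology.IsBounded C) (ψ : Z →L[ℝ] ℝ) {s : ℝ} {w₀ : Z} (hw₀ : w₀ ∈ C) (hs : s < ψ w₀)
    {ε : ℝ} (hε : 0 < ε) :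
    ∃ w ∈ C, s < ψ w ∧ w ∉ convexHull ℝ {w' ∈ C | ε ≤ ‖w' - w‖} := by
  by_contra! H
  have hstep : ∀ w : Z, ∃ (ν : Measure ℕ) (c : ℕ → Z), IsProbabilityMeasure ν ∧
      ∫ j, c j ∂ν = w ∧ (w ∈ C → ∀ j, c j ∈ C) ∧
      (w ∈ C → s < ψ w → ∀ j, ε ≤ ‖c j - w‖) := by
    intro w
    by_cases hw : w ∈ C ∧ s < ψ w
    · obtain ⟨ν, c, hν, hc, hint⟩ :=
        exists_measure_integral_eq_of_mem_convexHull (H w hw.1 hw.2)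
      exact ⟨ν, c, hν, hint, fun _ j => (hc j).1, fun _ _ j => (hc j).2⟩
    · exact ⟨Measure.dirac 0, fun _ => w, inferInstance, by simp, fun h _ => h,
        fun h1 h2 => absurd ⟨h1, h2⟩ hw⟩
  choose ν c hν hνc hcC hcε using hstep
  have hmem : ∀ n ω, walk w₀ c n ω ∈ C := by
    intro n ω
    induction n with
    | zero => exact hw₀
    | succ n ih => exact hcC _ ih _
  obtain ⟨R, hR⟩ := hC.exists_norm_le
  have hwR : ∀ n ω, ‖walk w₀ c n ω‖ ≤ R := fun n ω => hR _ (hmem n ω)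
  have hmart := martingale_walk w₀ c ν hνc hwR
  set μ := walkMeasure w₀ c ν with hμ
  have hlim := hZ.tendsto_eLpNorm_succ_sub iSup_piLE_nat hmart hwR
  set M := max (‖ψ‖ * R) (ψ w₀) with hM
  have hsM : s < M := hs.trans_le (le_max_right _ _)
  have hψM : ∀ n ω, ψ (walk w₀ c n ω) ≤ M := fun n ω =>
    (le_abs_self _).trans (((ψ.le_opNorm _).trans
      (mul_le_mul_of_nonneg_left (hwR n ω) (norm_nonneg _))).trans (le_max_left _ _))
  let A : ℕ → Set (ℕ → ℕ) := fun n => {ω | s < ψ (walk w₀ c n ω)}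
  have hψmeas : ∀ n, Measurable fun ω => ψ (walk w₀ c n ω) := fun n =>
    (ψ.continuous.comp_stronglyMeasurable
      ((hmart.stronglyMeasurable n).mono (Filtration.piLE.le n))).measurable
  have hA : ∀ n, MeasurableSet (A n) := fun n => measurableSet_lt measurable_const (hψmeas n)
  -- Integrating `ψ (walk n) ≤ s + (M - s) 1_A` gives a lower bound for the probability of `A`.
  have hAμ : ∀ n, (ψ w₀ - s) / (M - s) ≤ μ.real (A n) := by
    intro n
    rw [div_le_iff₀ (sub_pos.2 hsM)]
    have h1 : ∫ ω, ψ (walk w₀ c n ω) ∂μ = ψ w₀ := by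
      rw [ψ.integral_comp_comm (hmart.integrable n), ← setIntegral_univ,
        ← hmart.setIntegral_eq (Nat.zero_le n) MeasurableSet.univ, setIntegral_univ]
      simp [walk]
    have h2 : ∫ ω, ψ (walk w₀ c n ω) ∂μ ≤
        ∫ ω, (s + (A n).indicator (fun _ => M - s) ω) ∂μ := by
      refine integral_mono (ψ.integrable_comp (hmart.integrable n))
        ((integrable_const s).add ((integrable_const _).indicator (hA n))) fun ω => ?_
      by_cases hω : ω ∈ A n
      · simpa [hω] using hψM n ω
      · simpa [hω] using not_lt.1 hω
    rw [h1, integral_add (integrable_const s) ((integrable_const _).indicator (hA n)),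
      integral_indicator_const _ (hA n)] at h2
    simp only [integral_const, probReal_univ, smul_eq_mul] at h2
    linarith
  set p := (ψ w₀ - s) / (M - s) with hp
  have hp0 : 0 < p := div_pos (sub_pos.2 hs) (sub_pos.2 hsM)
  have hbig : ∀ n, ENNReal.ofReal (ε * p) ≤
      eLpNorm (walk w₀ c (n + 1) - walk w₀ c n) 1 μ := by
    intro n
    calc ENNReal.ofReal (ε * p) ≤ ENNReal.ofReal ε * μ (A n) := by
          rw [ENNReal.ofReal_mul hε.le, ← ofReal_measureReal]
          gcongr
          exact hAμ n
      _ = ∫⁻ _ in A n, ENNReal.ofReal ε ∂μ := by rw [setLIntegral_const]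
      _ ≤ ∫⁻ ω in A n, ‖(walk w₀ c (n + 1) - walk w₀ c n) ω‖ₑ ∂μ := by
          refine setLIntegral_mono' (hA n) fun ω hω => ?_
          rw [← ofReal_norm]
          exact ENNReal.ofReal_le_ofReal (hcε _ (hmem n ω) hω _)
      _ ≤ ∫⁻ ω, ‖(walk w₀ c (n + 1) - walk w₀ c n) ω‖ₑ ∂μ := setLIntegral_le_lintegral _ _
      _ = _ := eLpNorm_one_eq_lintegral_enorm.symm
  have h0 := ge_of_tendsto hlim (Filter.Eventually.of_forall hbig)
  rw [nonpos_iff_eq_zero, ENNReal.ofReal_eq_zero] at h0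
  exact absurd h0 (not_le.2 (mul_pos hε hp0))

theorem HasRadonNikodymProperty.prod_real {Z : Type*} [NormedAddCommGroup Z] [NormedSpace ℝ Z]
    [CompleteSpace Z] (hZ : HasRadonNikodymProperty Z) : HasRadonNikodymProperty (Z × ℝ) := by
  intro Ω _ μ _ G hG hvar
  let G₁ : VectorMeasure Ω Z := G.mapRange (AddMonoidHom.fst Z ℝ) continuous_fst
  let G₂ : SignedMeasure Ω := G.mapRange (AddMonoidHom.snd Z ℝ) continuous_snd
  have hG₁ : ∀ E, G₁ E = (G E).1 := fun E => rfl
  have hG₂ : ∀ E, G₂ E = (G E).2 := fun E => rfl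
  obtain ⟨g₁, hg₁, h₁⟩ := hZ Ω μ G₁ (fun E hE h0 => by rw [hG₁, hG E hE h0, Prod.fst_zero])
    (lt_of_le_of_lt (VectorMeasure.variation_le_of_forall_enorm_le (m := G.variation)
      (fun E _ => le_trans (by
        rw [hG₁, ← ofReal_norm, ← ofReal_norm]
        exact ENNReal.ofReal_le_ofReal (norm_fst_le _))
        (VectorMeasure.enorm_measure_le_variation G E)) Set.univ) hvar)
  have hac : VectorMeasure.AbsolutelyContinuous G₂ μ.toENNRealVectorMeasure := by
    refine VectorMeasure.AbsolutelyContinuous.mk fun E hE h0 => ?_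
    rw [Measure.toENNRealVectorMeasure_apply_measurable hE] at h0
    rw [hG₂, hG E hE h0, Prod.snd_zero]
  have hint := SignedMeasure.integrable_rnDeriv G₂ μ
  refine ⟨fun ω => (g₁ ω, G₂.rnDeriv μ ω), hg₁.prodMk hint, fun E hE => ?_⟩
  rw [integral_pair hg₁.integrableOn hint.integrableOn]
  refine Prod.ext ?_ ?_
  · rw [← hG₁, h₁ E hE]
  · rw [← hG₂]
    nth_rw 1 [← SignedMeasure.withDensityᵥ_rnDeriv_eq G₂ μ hac]
    exact withDensityᵥ_apply hint hE

/-! ### Subspaces whose quotient has the Radon–Nikodým property -/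

section

variable {X Z : Type*} [NormedAddCommGroup X] [NormedSpace ℝ X] [NormedAddCommGroup Z]
  [NormedSpace ℝ Z]

theorem SliceDaugavet.mem_closure_convexHull_image [Nontrivial X]
    (h : SliceDaugavet (id : X → X)) (T : X →L[ℝ] Z) {x₀ : X} (hx₀ : ‖x₀‖ ≤ 1) (z : X) {ε : ℝ}
    (hε : 0 < ε) :
    T x₀ ∈ closure (convexHull ℝ (T '' {x | ‖x‖ ≤ 1 ∧ ‖z‖ + 1 - ε ≤ ‖z + x‖})) := by
  by_contra hT
  obtain ⟨ψ, u, hu, hux⟩ := geometric_hahn_banach_closed_point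
    (convex_convexHull ℝ _).closure isClosed_closure hT
  replace hu : ∀ x, ‖x‖ ≤ 1 → ‖z‖ + 1 - ε ≤ ‖z + x‖ → ψ (T x) < u := fun x h1 h2 =>
    hu _ (subset_closure (subset_convexHull ℝ _ ⟨x, ⟨h1, h2⟩, rfl⟩))
  by_cases hf : ψ.comp T = 0
  · obtain ⟨x₁, hx₁⟩ := exists_ne (0 : X)
    obtain ⟨g, hg, -⟩ := exists_dual_vector ℝ x₁ (norm_ne_zero_iff.2 hx₁)
    obtain ⟨x, h1, -, h2⟩ := h g (by rintro rfl; simp at hg) z ε hε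
    have h3 := hu x h1 h2
    have h4 : ∀ y, ψ (T y) = 0 := fun y => DFunLike.congr_fun hf y
    rw [h4] at h3 hux
    exact lt_asymm h3 hux
  · have h0 : 0 < ψ (T x₀) - u := sub_pos.2 hux
    obtain ⟨x, h1, h2, h3⟩ := h (ψ.comp T) hf z (min ε (ψ (T x₀) - u)) (lt_min hε h0)
    have h4 := hu x h1 (le_trans (by linarith [min_le_left ε (ψ (T x₀) - u)]) h3)
    have h5 : ψ (T x₀) ≤ ‖ψ.comp T‖ := (le_abs_self _).trans
      (((ψ.comp T).le_opNorm x₀).trans (mul_le_of_le_one_right (norm_nonneg _) hx₀))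
    have h6 : ‖ψ.comp T‖ - min ε (ψ (T x₀) - u) ≤ ψ (T x) := h2
    linarith [min_le_right ε (ψ (T x₀) - u)]

/-- The vectors `w` that can be approximated by values `T x`, where `x` in the unit ball may be
chosen almost orthogonal, in the sense of `ℓ₁`, to any given vector, form a convex set. -/
theorem convex_setOf_forall_exists_norm_add_le (T : X →L[ℝ] Z) (ε : ℝ) :
    Convex ℝ {w : Z | ∀ z : X, ∃ x, ‖x‖ ≤ 1 ∧ ‖T x - w‖ ≤ ε ∧ ‖z‖ + 1 - ε ≤ ‖z + x‖} := by
  rw [convex_iff_forall_pos]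
  intro w₁ h₁ w₂ h₂ a b ha hb hab z
  -- The condition for `a⁻¹ • z` and `x`, multiplied by `a`, is one for `z` and `a • x`.
  have hscale : ∀ {t : ℝ}, 0 < t → ∀ {y x : X}, ‖t⁻¹ • y‖ + 1 - ε ≤ ‖t⁻¹ • y + x‖ →
      ‖y‖ + t - t * ε ≤ ‖y + t • x‖ := by
    intro t ht y x hyx
    have h3 : y + t • x = t • (t⁻¹ • y + x) := by rw [smul_add, smul_inv_smul₀ ht.ne']
    have h4 : ‖y‖ = t * ‖t⁻¹ • y‖ := by
      rw [norm_smul, Real.norm_of_nonneg (inv_nonneg.2 ht.le), mul_inv_cancel_left₀ ht.ne']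
    rw [h3, norm_smul t, Real.norm_of_nonneg ht.le, h4]
    nlinarith
  obtain ⟨x₁, hx₁, hT₁, hz₁⟩ := h₁ (a⁻¹ • z)
  obtain ⟨x₂, hx₂, hT₂, hz₂⟩ := h₂ (b⁻¹ • (z + a • x₁))
  have e₁ := hscale ha hz₁
  have e₂ := hscale hb hz₂
  refine ⟨a • x₁ + b • x₂, ?_, ?_, ?_⟩
  · refine (norm_add_le _ _).trans ?_
    rw [norm_smul, norm_smul, Real.norm_of_nonneg ha.le, Real.norm_of_nonneg hb.le]
    nlinarith
  · have : T (a • x₁ + b • x₂) - (a • w₁ + b • w₂) = a • (T x₁ - w₁) + b • (T x₂ - w₂) := by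
      simp only [map_add, map_smul]
      module
    rw [this]
    refine (norm_add_le _ _).trans ?_
    rw [norm_smul, norm_smul, Real.norm_of_nonneg ha.le, Real.norm_of_nonneg hb.le]
    calc a * ‖T x₁ - w₁‖ + b * ‖T x₂ - w₂‖ ≤ a * ε + b * ε := by gcongr
      _ = ε := by rw [← add_mul, hab, one_mul]
  · rw [← add_assoc]
    have : a * ε + b * ε = ε := by rw [← add_mul, hab, one_mul]
    linarith

/-- An operator `T` from a Daugavet space to a space with the Radon–Nikodým property does not
see the vectors `x` that witness the Daugavet property: they can be chosen with `T x` close to a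
given value. Otherwise a functional `ψ` separates some `T x₀` from the convex set of values for
which this is possible. A point `w` of the slice of (an open neighbourhood of) the image of
the ball cut off by `ψ` is then a convex combination of values `T x` far from `w`, by the Daugavet
property, in contradiction to the Radon–Nikodým property. -/
theorem SliceDaugavet.exists_norm_map_sub_le [Nontrivial X] [CompleteSpace Z]
    (h : SliceDaugavet (id : X → X)) (hZ : HasRadonNikodymProperty Z) (T : X →L[ℝ] Z) {x₀ : X}
    (hx₀ : ‖x₀‖ ≤ 1) (z : X) {ε : ℝ} (hε : 0 < ε) :
    ∃ x, ‖x‖ ≤ 1 ∧ ‖T x - T x₀‖ ≤ ε ∧ ‖z‖ + 1 - ε ≤ ‖z + x‖ := by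
  suffices H : ∀ ε > 0, T x₀ ∈ closure
      {w : Z | ∀ z : X, ∃ x, ‖x‖ ≤ 1 ∧ ‖T x - w‖ ≤ ε ∧ ‖z‖ + 1 - ε ≤ ‖z + x‖} by
    obtain ⟨w, hw, hwT⟩ := Metric.mem_closure_iff.1 (H (ε / 2) (half_pos hε)) _ (half_pos hε)
    obtain ⟨x, h1, h2, h3⟩ := hw z
    refine ⟨x, h1, ?_, by linarith⟩
    rw [dist_comm, dist_eq_norm] at hwT
    calc ‖T x - T x₀‖ = ‖(T x - w) + (w - T x₀)‖ := by rw [sub_add_sub_cancel]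
      _ ≤ ‖T x - w‖ + ‖w - T x₀‖ := norm_add_le _ _
      _ ≤ ε := by linarith
  intro ε hε
  by_contra hT
  obtain ⟨ψ, u, hu, hux⟩ := geometric_hahn_banach_closed_point
    (convex_setOf_forall_exists_norm_add_le T ε).closure isClosed_closure hT
  let C : Set Z := {w | ∃ x, ‖x‖ ≤ 1 ∧ ‖w - T x‖ < ε / 2}
  have hC : Bornology.IsBounded C := by
    refine isBounded_iff_forall_norm_le.2 ⟨‖T‖ + ε / 2, ?_⟩
    rintro w ⟨x, hx, hwx⟩
    calc ‖w‖ = ‖T x + (w - T x)‖ := by rw [add_sub_cancel]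
      _ ≤ ‖T x‖ + ‖w - T x‖ := norm_add_le _ _
      _ ≤ ‖T‖ + ε / 2 := add_le_add
        ((T.le_opNorm x).trans (mul_le_of_le_one_right (norm_nonneg _) hx)) hwx.le
  obtain ⟨w, ⟨x₁, hx₁, hwx₁⟩, huw, hw⟩ := hZ.exists_notMem_convexHull hC ψ
    (w₀ := T x₀) ⟨x₀, hx₀, by simpa using hε⟩ hux (half_pos hε)
  have hwW : ¬ ∀ z : X, ∃ x, ‖x‖ ≤ 1 ∧ ‖T x - w‖ ≤ ε ∧ ‖z‖ + 1 - ε ≤ ‖z + x‖ := fun h' =>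
    lt_asymm huw (hu w (subset_closure h'))
  push Not at hwW
  obtain ⟨z, hz⟩ := hwW
  obtain ⟨d, hd, hdx₁⟩ := Metric.mem_closure_iff.1
    (h.mem_closure_convexHull_image T hx₁ z hε) _ (sub_pos.2 hwx₁)
  -- `w` is a small translate of `d`, a convex combination of values far away from `w`.
  have hdw : ‖w - d‖ < ε / 2 := by
    rw [dist_eq_norm] at hdx₁
    calc ‖w - d‖ = ‖(w - T x₁) + (T x₁ - d)‖ := by rw [sub_add_sub_cancel]
      _ ≤ ‖w - T x₁‖ + ‖T x₁ - d‖ := norm_add_le _ _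
      _ < ε / 2 := by linarith
  refine hw ?_
  have hsub : T '' {x | ‖x‖ ≤ 1 ∧ ‖z‖ + 1 - ε ≤ ‖z + x‖} ⊆
      (fun v => (w - d) + v) ⁻¹' convexHull ℝ {w' ∈ C | ε / 2 ≤ ‖w' - w‖} := by
    rintro _ ⟨x, ⟨hx1, hx2⟩, rfl⟩
    refine subset_convexHull ℝ _ ⟨⟨x, hx1, by simpa using hdw⟩, ?_⟩
    have h1 : ε < ‖T x - w‖ := by
      by_contra! h1
      exact not_le.2 (hz x hx1 h1) hx2
    have h2 : T x - w = (w - d + T x - w) - (w - d) := by abel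
    have h3 := norm_sub_le (w - d + T x - w) (w - d)
    rw [← h2] at h3
    linarith
  have := convexHull_min hsub ((convex_convexHull ℝ _).translate_preimage_right _) hd
  simpa using this

end

section

variable {𝕜 X : Type*} [RCLike 𝕜] [NormedAddCommGroup X] [NormedSpace 𝕜 X] [NormedSpace ℝ X]
  [IsScalarTower ℝ 𝕜 X] [CompleteSpace X]

/-- A functional on `Y` is extended to `X` and combined with the quotient map to an operator `T`
with values in `(X ⧸ Y) × ℝ`; a vector at which `T` almost takes a value `(0, t)` is close to `Y`. -/
theorem SliceDaugavet.subtypeL_of_hasRadonNikodymProperty (h : SliceDaugavet (id : X → X))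
    (Y : Submodule 𝕜 X) [IsClosed (Y : Set X)] (hY : HasRadonNikodymProperty (X ⧸ Y)) :
    SliceDaugavet Y.subtypeL := by
  intro f hf z ε hε
  obtain ⟨f', hf'f, hf'n⟩ := exists_extension_norm_eq (Y.restrictScalars ℝ) (f : Y →L[ℝ] ℝ)
  replace hf'f : ∀ y : Y, f' y = f y := hf'f
  replace hf'n : ‖f'‖ = ‖f‖ := hf'n
  have : Nontrivial X := by
    by_contra hX
    rw [not_nontrivial_iff_subsingleton] at hX
    exact hf (Subsingleton.elim _ _)
  let q : X →L[ℝ] X ⧸ Y := (Y.mkQL).restrictScalars ℝ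
  set δ := ε / (5 + 4 * ‖f‖) with hδ
  have hδ0 : 0 < δ := by positivity
  have hδε : δ * (5 + 4 * ‖f‖) = ε := div_mul_cancel₀ _ (by positivity)
  obtain ⟨y₀, hy₀, hfy₀⟩ : ∃ y₀ : Y, ‖y₀‖ ≤ 1 ∧ ‖f‖ - δ ≤ f y₀ := by
    obtain ⟨y, hy, hfy⟩ := f.exists_lt_apply_of_lt_opNorm (sub_lt_self ‖f‖ hδ0)
    rcases abs_cases (f y) with ⟨h1, -⟩ | ⟨h1, -⟩
    · exact ⟨y, hy.le, by rw [Real.norm_eq_abs, h1] at hfy; exact hfy.le⟩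
    · exact ⟨-y, by rw [norm_neg]; exact hy.le,
        by rw [map_neg, ← h1, ← Real.norm_eq_abs]; exact hfy.le⟩
  obtain ⟨x, hx1, hx2, hx3⟩ := h.exists_norm_map_sub_le hY.prod_real (q.prod f')
    (x₀ := (y₀ : X)) hy₀ z hδ0
  have hq : ‖q x‖ ≤ δ := by
    have h1 : q y₀ = 0 := (Submodule.Quotient.mk_eq_zero Y).2 y₀.2
    have h2 := (norm_fst_le _).trans hx2
    simpa [h1] using h2
  have hf'x : |f' x - f y₀| ≤ δ := by
    have h2 := (norm_snd_le _).trans hx2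
    simpa [hf'f] using h2
  obtain ⟨x', hx', hx'n⟩ := Submodule.Quotient.norm_mk_lt (q x) hδ0
  have hy₁ : x - x' ∈ Y := by
    rw [← Submodule.Quotient.mk_eq_zero Y]
    exact (map_sub q x x').trans (sub_eq_zero.2 hx'.symm)
  set y₁ : Y := ⟨x - x', hy₁⟩ with hy₁def
  have hx'δ : ‖x'‖ ≤ 2 * δ := by linarith
  have hy₁n : ‖y₁‖ ≤ 1 + 2 * δ := by
    have : ‖x - x'‖ ≤ 1 + 2 * δ := (norm_sub_le _ _).trans (add_le_add hx1 hx'δ)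
    exact this
  have hfy₁ : ‖f‖ - 2 * δ - ‖f‖ * (2 * δ) ≤ f y₁ := by
    rw [← hf'f, hy₁def]
    simp only [map_sub]
    have h1 : f' x' ≤ ‖f‖ * (2 * δ) := by
      refine (le_abs_self _).trans ((f'.le_opNorm x').trans ?_)
      rw [hf'n]
      gcongr
    linarith [(abs_le.1 hf'x).1]
  -- The vector `y₁` has to be scaled down to the unit ball.
  set r := (1 + 2 * δ)⁻¹ with hr
  have hr0 : 0 < r := by positivity
  have hr1 : r * (1 + 2 * δ) = 1 := inv_mul_cancel₀ (by positivity)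
  have hry : ‖r • y₁ - y₁‖ ≤ 2 * δ := by
    have h1 : r • y₁ - y₁ = (r - 1) • y₁ := by module
    rw [h1, norm_smul, Real.norm_eq_abs, abs_sub_comm, abs_of_nonneg (by nlinarith)]
    calc (1 - r) * ‖y₁‖ ≤ (1 - r) * (1 + 2 * δ) := by
          gcongr
          nlinarith
      _ = 2 * δ := by linear_combination -hr1
  refine ⟨r • y₁, ?_, ?_, ?_⟩
  · rw [norm_smul, Real.norm_of_nonneg hr0.le, ← hr1]
    gcongr
  · have h1 : f y₁ - f (r • y₁) ≤ ‖f‖ * (2 * δ) := by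
      rw [← map_sub]
      refine (le_abs_self _).trans ((f.le_opNorm _).trans ?_)
      rw [norm_sub_rev]
      gcongr
    nlinarith [norm_nonneg f]
  · have h1 : z + x = (z + Y.subtypeL (r • y₁)) - ((r • y₁ - y₁ : Y) : X) + x' := by
      simp only [hy₁def, Submodule.subtypeL_apply, Submodule.coe_sub, Submodule.coe_smul_of_tower]
      abel
    have h2 := norm_add_le ((z + Y.subtypeL (r • y₁)) - ((r • y₁ - y₁ : Y) : X)) x'
    have h3 := norm_sub_le (z + Y.subtypeL (r • y₁)) ((r • y₁ - y₁ : Y) : X)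
    have h4 : ‖((r • y₁ - y₁ : Y) : X)‖ ≤ 2 * δ := hry
    rw [← h1] at h2
    nlinarith [norm_nonneg f]

end

theorem mainTheorem3 {𝕜 : Type*} {X : Type u} [RCLike 𝕜]
    [NormedAddCommGroup X] [NormedSpace 𝕜 X] [NormedSpace ℝ X] [IsScalarTower ℝ 𝕜 X]
    [CompleteSpace X] (hX : IsDaugavetSpace 𝕜 X)
    (Y : Submodule 𝕜 X) [IsClosed (Y : Set X)] :
    (HasRadonNikodymProperty (X ⧸ Y) → IsDaugavetPair Y) ∧
    (IsReflexiveSpace 𝕜 Y → IsDaugavetSpace 𝕜 (X ⧸ Y)) :=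
  ⟨fun hY => (hX.sliceDaugavet.subtypeL_of_hasRadonNikodymProperty Y hY).hasDaugavetProperty
      Y.norm_subtypeL_le,
    fun hY => SliceDaugavet.hasDaugavetProperty (J := ContinuousLinearMap.id 𝕜 (X ⧸ Y))
      ContinuousLinearMap.norm_id_le (hX.sliceDaugavet.quotient_of_isReflexiveSpace Y hY)⟩
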